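/- For $n\ge 0$ put $N=2^n$, and for $k\ge 0$ let $$w_{\mathrm{low}}(n,k)=\Big\lfloor N\sin^2\Big(\tfrac{k}{2k+1}\tfrac{\pi}{2}\Big)\Big\rceil ,\qquad w_{\mathrm{high}}(n,k)=\Big\lfloor N\cos^2\Big(\tfrac{k}{2k+1}\tfrac{\pi}{2}\Big)\Big\rceil ,$$ where $\lfloor q\rceil$ is the integer nearest to $q$ (rounding up at a tie). The weight of a Boolean function $f:\{0,1\}^n\to\{0,1\}$ is the number of inputs $x$ with $f(x)=1$. The majority-vote algorithm with $g$ queries evaluates $f$ at $g$ independent uniformly random inputs and guesses "lower weight" if the answer $0$ occurs more often than $1$, "higher weight" if $1$ occurs more often than $0$, and guesses by a fair coin in case of a tie. For each $k\in\mathbb N$ let $n_k\in\mathbb N$ be such that $k/2^{n_k}\to 0$ as $k\to\infty$ (this holds in particular if $k$ is bounded by a polynomial in $n_k$). Let $f_k$ be a Boolean function on $n_k$ variables whose weight is $w_{\mathrm{low}}(n_k,k)$ or $w_{\mathrm{high}}(n_k,k)$, with a specified choice of which of the two alternatives holds. Let $p_s(k)$ be the probability that the majority-vote algorithm with $g(k)$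 queries, run on $f_k$, guesses the specified alternative. The number of queries is $g(k)=k^s$ up to rounding, that is, $g(k)\in\mathbb N$ and $|g(k)-k^s|\le 1$ for all $k$, with $s$ a fixed real number. **Theorem.** As $k\to\infty$: 1. if $s=1$, then $p_s(k)\to \tfrac12$; 2. if $s=2$, then $p_s(k)\to p$ for an absolute constant $p<0.8$, the same for all choices of $n_k$, $f_k$ and $g$ as above; in particular $p_s(k)<0.8$ for all large $k$; 3. if $s>2$, then $p_s(k)\to 1$. -/

import Mathlib

namespace WeightDecision

/-- A Boolean function on `n` variables. -/
abbrev BoolFun (n : ℕ) : Type := (Fin n → Bool) → Bool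

/-- The weight of a Boolean function: the number of inputs with output one. -/
def weight {n : ℕ} (f : BoolFun n) : ℕ :=
  (Finset.univ.filter fun x => f x = true).card

/-- The two alternatives of the promise: `f` has the lower or the higher of the two weights. -/
inductive Verdict : Type
  | lower
  | higher

/-- The two promised weights: the integers nearest to `N sin² (k/(2k+1) · π/2)` and to
`N cos² (k/(2k+1) · π/2)`, where `N = 2 ^ n`. -/
noncomputable def promisedWeight (n k : ℕ) : Verdict → ℤ
  | .lower => round ((2 : ℝ) ^ n * Real.sin ((k : ℝ) / (2 * k + 1) * (Real.pi / 2)) ^ 2)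
  | .higher => round ((2 : ℝ) ^ n * Real.cos ((k : ℝ) / (2 * k + 1) * (Real.pi / 2)) ^ 2)

/-- The joint law of the `g` oracle answers when the oracle for `f` is queried at `g` independent
uniformly random inputs. -/
noncomputable def oracleAnswers {n : ℕ} (f : BoolFun n) (g : ℕ) : PMF (Fin g → Bool) :=
  (PMF.uniformOfFintype (Fin g → Fin n → Bool)).map fun xs i => f (xs i)

/-- How many of the answers are equal to `b`. -/
def countAnswers {g : ℕ} (a : Fin g → Bool) (b : Bool) : ℕ :=
  (Finset.univ.filter fun i => a i = b).card

/-- A fair coin between the two alternatives. -/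
noncomputable def fairGuess : PMF Verdict :=
  (PMF.uniformOfFintype Bool).map fun b => if b then .higher else .lower

/-- The majority rule: guess the lower weight if zero appears more often than one, the higher
weight if one appears more often than zero, and guess at random in case of a tie. -/
noncomputable def majorityRule {g : ℕ} (a : Fin g → Bool) : PMF Verdict :=
  if countAnswers a true < countAnswers a false then PMF.pure .lower
  else if countAnswers a false < countAnswers a true then PMF.pure .higher
  else fairGuess

/-- The output law of the majority-vote algorithm with `g` oracle queries. -/
noncomputable def majorityVote {n : ℕ} (f : BoolFun n) (g : ℕ) : PMF Verdict :=
  (oracleAnswers f g).bind majorityRule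

/-- The probability that the majority-vote algorithm with `g` queries outputs the alternative `c`
when it is run on `f`; this is the success probability when `c` is the true one. -/
noncomputable def successProb {n : ℕ} (f : BoolFun n) (g : ℕ) (c : Verdict) : ℝ :=
  (majorityVote f g c).toReal

/-- With `g k` queries at parameter `k`, the majority vote has asymptotic success probability `p`
as `k → ∞`: for all numbers of variables `n k` with `k = o(2 ^ n k)` (in particular whenever `k` is
bounded by a polynomial in `n k`) and all functions `f k` on `n k` variables that have one
of the two promised weights, the one named by `c k`. -/
def HasAsymptoticSuccess (g : ℕ → ℕ) (p : ℝ) : Prop :=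
  ∀ (n : ℕ → ℕ) (c : ℕ → Verdict) (f : ∀ k, BoolFun (n k)),
    Filter.Tendsto (fun k : ℕ => (k : ℝ) / (2 : ℝ) ^ n k) Filter.atTop (nhds 0) →
    (∀ k, (weight (f k) : ℤ) = promisedWeight (n k) k (c k)) →
    Filter.Tendsto (fun k => successProb (f k) (g k) (c k)) Filter.atTop (nhds p)

/-- `g k` equals `k ^ s` up to rounding to a neighbouring integer. This leaves room for rounding
up, down, or to an odd integer. -/
def IsRoundedPower (g : ℕ → ℕ) (s : ℝ) : Prop :=
  ∀ k : ℕ, |(g k : ℝ) - (k : ℝ) ^ s| ≤ 1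

end WeightDecision

namespace WeightDecision

open MeasureTheory ProbabilityTheory Filter
open scoped Topology

/-! Score each answer +1 or -1 according to whether it supports the true alternative. The margin is
then a sum of `g` independent votes whose mean is the bias δ, and the guess depends on its sign. For
both promised weights δ = sin(π/(4k+2)) up to 2⁻ⁿ, so kδ → π/4 because k/2ⁿ → 0
(`tendsto_mul_bias`).

If g/k² → r, then √g·δ → √r·π/4. A central limit theorem for the varying vote laws
(`tendsto_charFun_margin`) gives success probability tending to P(Z > 0) with Z ~ N(√r·π/4, 1). Here
s = 1 means r = 0 and limit 1/2; s = 2 means r = 1 and limit Φ(π/4) ≈ 0.784. For s > 2, gδ² → ∞ and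
a Chernoff bound suffices. -/

/-- The answer `y` as a signed vote for the bit `b`. -/
def signedVote (b y : Bool) : ℝ := if y = b then 1 else -1

/-- The number of votes for `b` minus the number of votes against `b`. -/
def margin {g : ℕ} (b : Bool) (a : Fin g → Bool) : ℝ := ∑ i, signedVote b (a i)

/-- The expected signed vote for the bit `b` of a single random query. -/
noncomputable def bias {n : ℕ} (f : BoolFun n) (b : Bool) : ℝ :=
  (∑ x, signedVote b (f x)) / 2 ^ n

/-- The answer that counts as a vote for a verdict. -/
def Verdict.bit : Verdict → Bool
  | .lower => false
  | .higher => true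

/-- The law of the oracle answers as a measure. -/
noncomputable abbrev answerLaw {n : ℕ} (f : BoolFun n) (g : ℕ) : Measure (Fin g → Bool) :=
  (oracleAnswers f g).toMeasure

/-! ### Independent answers and the success probability. -/

theorem integral_prod_answerLaw {𝕜 : Type*} [RCLike 𝕜] {n : ℕ} (f : BoolFun n) (g : ℕ)
    (φ : Bool → 𝕜) :
    ∫ a, ∏ i, φ (a i) ∂answerLaw f g = ((∑ x, φ (f x)) / 2 ^ n) ^ g := by
  rw [answerLaw, oracleAnswers, ← PMF.toMeasure_map _ _ (.of_discrete),
    integral_map (Measurable.of_discrete.aemeasurable)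
      (Measurable.of_discrete.aestronglyMeasurable), PMF.integral_eq_sum]
  simp only [PMF.uniformOfFintype_apply, ← Finset.smul_sum]
  rw [← Fintype.sum_pow (fun x => φ (f x)) g, div_pow, RCLike.real_smul_eq_coe_mul]
  have h2 : (algebraMap ℝ 𝕜) 2 = 2 := map_ofNat _ 2
  simp [div_eq_inv_mul, h2]

/-- On {1, -1} every φ is affine: its even part plus the vote times its odd part. Hence only the
bias of `f` enters. Both characteristic functions and exponential moments of the margin are
instances. -/
theorem integral_prod_signedVote {𝕜 : Type*} [RCLike 𝕜] {n : ℕ} (f : BoolFun n) (g : ℕ)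
    (b : Bool) (φ : ℝ → 𝕜) :
    ∫ a, ∏ i, φ (signedVote b (a i)) ∂answerLaw f g =
      ((φ 1 + φ (-1)) / 2 + bias f b * ((φ 1 - φ (-1)) / 2)) ^ g := by
  rw [integral_prod_answerLaw f g fun y => φ (signedVote b y)]
  congr 1
  have h (y : Bool) : φ (signedVote b y) =
      (φ 1 + φ (-1)) / 2 + (signedVote b y : 𝕜) * ((φ 1 - φ (-1)) / 2) := by
    unfold signedVote
    split_ifs <;> simp <;> ring
  simp only [h, Finset.sum_add_distrib, ← Finset.sum_mul, bias]
  have h2 : (algebraMap ℝ 𝕜) 2 = 2 := map_ofNat _ 2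
  simp [h2]
  field_simp

theorem margin_eq_countAnswers {g : ℕ} (b : Bool) (a : Fin g → Bool) :
    margin b a = countAnswers a b - countAnswers a (!b) := by
  have h (i : Fin g) : signedVote b (a i) =
      (if a i = b then (1 : ℝ) else 0) - if a i = !b then 1 else 0 := by
    unfold signedVote
    cases b <;> cases a i <;> simp
  simp [margin, countAnswers, h, Finset.sum_sub_distrib]

theorem majorityRule_toReal {g : ℕ} (a : Fin g → Bool) (c : Verdict) :
    (majorityRule a c).toReal =
      {a | 0 < margin c.bit a}.indicator 1 a + {a | margin c.bit a = 0}.indicator 1 a / 2 := by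
  have hf (c : Verdict) : fairGuess c = 2⁻¹ := by
    cases c <;> simp [fairGuess, PMF.map_apply, tsum_fintype]
  simp only [Set.indicator, Set.mem_ofPred_eq, margin_eq_countAnswers, sub_pos, sub_eq_zero,
    Nat.cast_lt, Nat.cast_inj, majorityRule]
  rcases lt_trichotomy (countAnswers a true) (countAnswers a false) with h | h | h
  · cases c <;> simp [Verdict.bit, h, h.not_gt, h.ne, h.ne']
  · cases c <;> simp [Verdict.bit, h, hf]
  · cases c <;> simp [Verdict.bit, h, h.not_gt, h.ne, h.ne']

theorem successProb_eq {n : ℕ} (f : BoolFun n) (g : ℕ) (c : Verdict) :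
    successProb f g c = (answerLaw f g).real {a | 0 < margin c.bit a} +
      (answerLaw f g).real {a | margin c.bit a = 0} / 2 := by
  have h (s : Set (Fin g → Bool)) :
      (answerLaw f g).real s = ∑ a, (oracleAnswers f g a).toReal * s.indicator 1 a := by
    rw [← integral_indicator_one .of_discrete, PMF.integral_eq_sum]
    simp
  rw [successProb, majorityVote, PMF.bind_apply, tsum_fintype, ENNReal.toReal_sum
    fun a _ => ENNReal.mul_ne_top (PMF.apply_ne_top _ _) (PMF.apply_ne_top _ _), h, h,
    Finset.sum_div, ← Finset.sum_add_distrib]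
  refine Finset.sum_congr rfl fun a _ => ?_
  rw [ENNReal.toReal_mul, majorityRule_toReal]
  ring

/-! ### Central limit theorem for the margin. -/

theorem tendsto_mul_sin_div {ι : Type*} {l : Filter ι} {u : ι → ℝ} (hu : Tendsto u l atTop)
    (t : ℝ) : Tendsto (fun i => u i * Real.sin (t / u i)) l (𝓝 t) := by
  have h0 : Tendsto (fun i => t / u i) l (𝓝 0) := hu.const_div_atTop t
  have h1 := ((Real.continuous_sinc.tendsto 0).comp h0).const_mul t
  rw [Real.sinc_zero, mul_one] at h1
  refine h1.congr' ?_
  filter_upwards [hu.eventually_ne_atTop 0] with i hi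
  by_cases ht : t = 0
  · simp [ht]
  · rw [Function.comp_apply, Real.sinc_of_ne_zero (div_ne_zero ht hi)]
    field_simp

/-- Since g·z converges and g → ∞, z → 0; then g·(log(1+z) - z) = O(|gz|·|z|) vanishes. -/
theorem tendsto_one_add_pow_exp {ι : Type*} {l : Filter ι} {g : ι → ℕ} {z : ι → ℂ} {w : ℂ}
    (hg : Tendsto g l atTop) (hz : Tendsto (fun i => g i * z i) l (𝓝 w)) :
    Tendsto (fun i => (1 + z i) ^ g i) l (𝓝 (Complex.exp w)) := by
  have hgR : Tendsto (fun i => (g i : ℝ)) l atTop := tendsto_natCast_atTop_atTop.comp hg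
  have hinv : Tendsto (fun i => ((g i : ℂ))⁻¹) l (𝓝 0) := by
    simpa using (tendsto_inv_atTop_zero.comp hgR).ofReal
  have hne : ∀ᶠ i in l, (g i : ℂ) ≠ 0 := by
    filter_upwards [hg.eventually_ne_atTop 0] with i hi using Nat.cast_ne_zero.2 hi
  have hz0 : Tendsto z l (𝓝 0) := by
    have := hinv.mul hz
    rw [zero_mul] at this
    refine this.congr' ?_
    filter_upwards [hne] with i hi
    field_simp
  have hlog : Tendsto (fun i => g i * Complex.log (1 + z i)) l (𝓝 w) := by
    refine hz.congr_dist ?_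
    have hb : Tendsto (fun i => ‖(g i * z i : ℂ)‖ * (‖z i‖ * (1 - ‖z i‖)⁻¹ / 2)) l (𝓝 0) := by
      have h1 : Tendsto (fun i => ‖z i‖) l (𝓝 0) := by simpa using hz0.norm
      have h2 : Tendsto (fun i => (1 - ‖z i‖)⁻¹) l (𝓝 1) := by
        simpa using (h1.const_sub 1).inv₀ (by norm_num)
      simpa using hz.norm.mul ((h1.mul h2).div_const 2)
    refine squeeze_zero' (.of_forall fun _ => dist_nonneg) ?_ hb
    filter_upwards [hz0.norm.eventually_lt_const (u := 1) (by simp)] with i hi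
    rw [dist_comm, dist_eq_norm, ← mul_sub, norm_mul, norm_mul, mul_assoc]
    refine mul_le_mul_of_nonneg_left ?_ (norm_nonneg _)
    refine (Complex.norm_log_one_add_sub_self_le hi).trans_eq ?_
    ring
  refine ((Complex.continuous_exp.tendsto w).comp hlog).congr' ?_
  filter_upwards [hz0.eventually_ne (show (0 : ℂ) ≠ -1 by simp)] with i hi
  rw [Function.comp_apply, Complex.exp_nat_mul, Complex.exp_log]
  intro h
  exact hi (by linear_combination h)

theorem charFun_map_margin {n : ℕ} (f : BoolFun n) (g : ℕ) (b : Bool) (t : ℝ) :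
    charFun ((answerLaw f g).map fun a => margin b a / √g) t =
      (1 + ((Real.cos (t / √g) - 1 : ℝ) + (bias f b * Real.sin (t / √g) : ℝ) * Complex.I)) ^ g := by
  rw [charFun_apply_real, integral_map Measurable.of_discrete.aemeasurable
    (Continuous.aestronglyMeasurable (by fun_prop))]
  have h (a : Fin g → Bool) : Complex.exp (t * (margin b a / √g : ℝ) * Complex.I) =
      ∏ i, Complex.exp ((t / √g : ℝ) * signedVote b (a i) * Complex.I) := by
    rw [← Complex.exp_sum, ← Finset.sum_mul, ← Finset.mul_sum, margin]
    push_cast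
    ring_nf
  simp_rw [h]
  rw [integral_prod_signedVote f g b fun x => Complex.exp ((t / √g : ℝ) * x * Complex.I)]
  congr 1
  generalize t / √g = u
  have h1 := Complex.exp_mul_I u
  have h2 := Complex.exp_mul_I (-u)
  rw [Complex.cos_neg, Complex.sin_neg] at h2
  push_cast
  rw [mul_one, mul_neg_one, h1, h2, ← RCLike.ofReal_eq_complex_ofReal]
  simp
  ring

/-- The margin of a growing number of queries, normalized by `√g`, is asymptotically normal. -/
theorem tendsto_charFun_margin {n : ℕ → ℕ} (f : ∀ k, BoolFun (n k)) (b : ℕ → Bool) {g : ℕ → ℕ}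
    {m : ℝ} (hg : Tendsto g atTop atTop)
    (hm : Tendsto (fun k => √(g k) * bias (f k) (b k)) atTop (𝓝 m)) (t : ℝ) :
    Tendsto (fun k => charFun ((answerLaw (f k) (g k)).map fun a => margin (b k) a / √(g k)) t)
      atTop (𝓝 (charFun (gaussianReal m 1) t)) := by
  have hs : Tendsto (fun k => √(g k : ℝ)) atTop atTop :=
    Real.tendsto_sqrt_atTop.comp (tendsto_natCast_atTop_atTop.comp hg)
  simp_rw [charFun_map_margin, charFun_gaussianReal]
  refine tendsto_one_add_pow_exp hg ?_
  have h1 : Tendsto (fun k => (g k : ℝ) * (Real.cos (t / √(g k)) - 1)) atTop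
      (𝓝 (-t ^ 2 / 2)) := by
    -- Uses cos u - 1 = -2 sin²(u/2).
    have := ((tendsto_mul_sin_div hs (t / 2)).pow 2).const_mul (-2)
    convert! this using 2 with k
    · rw [mul_pow, Real.sq_sqrt (Nat.cast_nonneg _), Real.sin_sq_eq_half_sub]
      ring_nf
    · ring
  have h2 : Tendsto (fun k => (g k : ℝ) * (bias (f k) (b k) * Real.sin (t / √(g k)))) atTop
      (𝓝 (m * t)) := by
    refine (hm.mul (tendsto_mul_sin_div hs t)).congr fun k => ?_
    linear_combination bias (f k) (b k) * Real.sin (t / √(g k)) *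
      Real.mul_self_sqrt (Nat.cast_nonneg (g k))
  convert! h1.ofReal.add (h2.ofReal.mul_const Complex.I) using 2
  · push_cast
    ring
  · push_cast
    simp
    ring

/-- Portmanteau: the half-line and the tie event {0} both have frontier {0}, which is null for the
Gaussian limit. Ties therefore contribute nothing asymptotically. -/
theorem tendsto_successProb {n : ℕ → ℕ} (f : ∀ k, BoolFun (n k)) (c : ℕ → Verdict) {g : ℕ → ℕ}
    {m : ℝ} (hg : Tendsto g atTop atTop)
    (hm : Tendsto (fun k => √(g k) * bias (f k) (c k).bit) atTop (𝓝 m)) :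
    Tendsto (fun k => successProb (f k) (g k) (c k)) atTop
      (𝓝 ((gaussianReal m 1).real (Set.Ioi 0))) := by
  have hp (k : ℕ) : IsProbabilityMeasure
      ((answerLaw (f k) (g k)).map fun a => margin (c k).bit a / √(g k)) :=
    Measure.isProbabilityMeasure_map Measurable.of_discrete.aemeasurable
  have hw := ProbabilityMeasure.tendsto_of_tendsto_charFun
    (μ := fun k => (⟨_, hp k⟩ : ProbabilityMeasure ℝ))
    (μ₀ := (⟨gaussianReal m 1, inferInstance⟩ : ProbabilityMeasure ℝ))
    (tendsto_charFun_margin f _ hg hm)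
  have := nullSingletonClass_gaussianReal (μ := m) one_ne_zero
  have key {s : Set ℝ} (hs : MeasurableSet s) (h0 : frontier s = {0}) :
      Tendsto (fun k => (answerLaw (f k) (g k)).real {a | margin (c k).bit a / √(g k) ∈ s}) atTop
        (𝓝 ((gaussianReal m 1).real s)) := by
    have h1 := ProbabilityMeasure.tendsto_measure_of_null_frontier_of_tendsto' hw (E := s)
      (by rw [h0, ProbabilityMeasure.coe_mk]; exact measure_singleton 0)
    simp only [ProbabilityMeasure.coe_mk] at h1
    refine ((ENNReal.tendsto_toReal (measure_ne_top _ _)).comp h1).congr fun k => ?_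
    rw [Function.comp_apply, Measure.map_apply .of_discrete hs]
    rfl
  have hpos := key (measurableSet_Ioi (a := (0 : ℝ))) frontier_Ioi
  have hzero := (key (measurableSet_singleton (0 : ℝ)) (by simp [frontier])).div_const 2
  rw [measureReal_def (s := {0}), measure_singleton, ENNReal.toReal_zero, zero_div] at hzero
  refine (add_zero ((gaussianReal m 1).real (Set.Ioi 0)) ▸ hpos.add hzero).congr' ?_
  filter_upwards [hg.eventually_gt_atTop 0] with k hk
  have hk' : 0 < √(g k : ℝ) := Real.sqrt_pos.2 (Nat.cast_pos.2 hk)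
  simp [successProb_eq, hk', hk'.ne', div_pos_iff_of_pos_right]

/-! ### Numerical bounds for the Gaussian limit. -/

theorem gaussianReal_zero_one_Ioi_zero : (gaussianReal 0 1).real (Set.Ioi 0) = 1 / 2 := by
  have := nullSingletonClass_gaussianReal (μ := 0) one_ne_zero
  have h1 : (gaussianReal 0 1).real (Set.Iio 0) = (gaussianReal 0 1).real (Set.Ioi 0) := by
    conv_lhs => rw [← neg_zero (G := ℝ), ← gaussianReal_map_neg]
    rw [map_measureReal_apply (by fun_prop) measurableSet_Iio]
    simp [Set.preimage]
    rfl
  have h2 := probReal_compl_eq_one_sub (μ := gaussianReal 0 1) (measurableSet_Iio (a := (0 : ℝ)))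
  rw [Set.compl_Iio, ← measureReal_congr Ioi_ae_eq_Ici] at h2
  linarith

theorem gaussianReal_Ioi_zero_le {m : ℝ} (hm : 0 ≤ m) :
    (gaussianReal m 1).real (Set.Ioi 0) ≤
      1 / 2 + (√(2 * Real.pi))⁻¹ * (m - m ^ 3 / 6 + m ^ 5 / 40) := by
  have h1 : (gaussianReal m 1).real (Set.Ioi 0) = (gaussianReal 0 1).real (Set.Ioi (-m)) := by
    conv_lhs => rw [← zero_add m, ← gaussianReal_map_add_const]
    rw [map_measureReal_apply (by fun_prop) measurableSet_Ioi]
    congr 1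
    ext x
    simp [neg_lt_iff_pos_add]
  -- With y = x²/2: e⁻ʸ ≤ 1/(1+y+y²/2) ≤ 1-y+y²/2, because (1+y²/2)² - y² = 1 + y⁴/4 ≥ 1.
  have hexp (x : ℝ) : Real.exp (-x ^ 2 / 2) ≤ 1 - x ^ 2 / 2 + x ^ 4 / 8 := by
    have hq := Real.quadratic_le_exp_of_nonneg (x := x ^ 2 / 2) (by positivity)
    rw [neg_div, Real.exp_neg]
    refine inv_le_of_inv_le₀ (by nlinarith [sq_nonneg (x ^ 2 - 2)]) (le_trans ?_ hq)
    refine inv_le_of_inv_le₀ (by positivity) ?_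
    rw [inv_le_iff_one_le_mul₀ (by positivity)]
    nlinarith [sq_nonneg (x ^ 4)]
  have h2 : (gaussianReal 0 1).real (Set.Ioc (-m) 0) ≤
      (√(2 * Real.pi))⁻¹ * (m - m ^ 3 / 6 + m ^ 5 / 40) := by
    rw [measureReal_def, gaussianReal_apply_eq_integral _ one_ne_zero, ENNReal.toReal_ofReal
      (integral_nonneg fun _ => gaussianPDFReal_nonneg _ _ _),
      ← intervalIntegral.integral_of_le (by linarith)]
    have h3 : ∫ x in (-m)..0, (√(2 * Real.pi))⁻¹ * (1 - x ^ 2 / 2 + x ^ 4 / 8) =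
        (√(2 * Real.pi))⁻¹ * (m - m ^ 3 / 6 + m ^ 5 / 40) := by
      rw [intervalIntegral.integral_const_mul, intervalIntegral.integral_add
        (Continuous.intervalIntegrable (by fun_prop) _ _)
        (Continuous.intervalIntegrable (by fun_prop) _ _), intervalIntegral.integral_sub
        (Continuous.intervalIntegrable (by fun_prop) _ _)
        (Continuous.intervalIntegrable (by fun_prop) _ _)]
      congr 1
      simp
      ring
    rw [← h3]
    refine intervalIntegral.integral_mono_on (by linarith)
      (integrable_gaussianPDFReal 0 1).intervalIntegrable
      (Continuous.intervalIntegrable (by fun_prop) _ _) fun x _ => ?_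
    rw [gaussianPDFReal]
    simpa using mul_le_mul_of_nonneg_left (hexp x) (by positivity)
  rw [h1, ← Set.Ioc_union_Ioi_eq_Ioi (neg_nonpos.2 hm),
    measureReal_union (Set.Ioc_disjoint_Ioi le_rfl) measurableSet_Ioi,
    gaussianReal_zero_one_Ioi_zero]
  linarith

theorem gaussianReal_pi_div_four_lt : (gaussianReal (Real.pi / 4) 1).real (Set.Ioi 0) < 4 / 5 := by
  refine (gaussianReal_Ioi_zero_le (by positivity)).trans_lt ?_
  have hl := Real.pi_gt_d2
  have hu := Real.pi_lt_d2
  have hs : (5 / 2 : ℝ) < √(2 * Real.pi) := Real.lt_sqrt_of_sq_lt (by linarith)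
  have hs' : (√(2 * Real.pi))⁻¹ < 2 / 5 := by
    rw [inv_lt_comm₀ (by positivity) (by norm_num)]
    linarith
  have h3 : (3.14 / 4 : ℝ) ^ 3 ≤ (Real.pi / 4) ^ 3 := by gcongr
  have h5 : (Real.pi / 4) ^ 5 ≤ (3.15 / 4) ^ 5 := by gcongr
  -- The target splits as 4/5 = 1/2 + (2/5)·(3/4).
  have hp : Real.pi / 4 - (Real.pi / 4) ^ 3 / 6 + (Real.pi / 4) ^ 5 / 40 < 3 / 4 := by
    norm_num at h3 h5 ⊢
    linarith
  have hnn : 0 ≤ Real.pi / 4 - (Real.pi / 4) ^ 3 / 6 + (Real.pi / 4) ^ 5 / 40 := by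
    nlinarith [pow_pos Real.pi_pos 5, mul_pos Real.pi_pos Real.pi_pos]
  nlinarith

/-! ### Exponential bound for many queries. -/

/-- A Chernoff bound for the probability that the majority vote fails. -/
theorem one_sub_exp_le_successProb {n : ℕ} (f : BoolFun n) (g : ℕ) (c : Verdict)
    (h0 : 0 ≤ bias f c.bit) :
    1 - Real.exp (-(g * bias f c.bit ^ 2 / 4)) ≤ successProb f g c := by
  set δ := bias f c.bit with hδ
  have hδ1 : δ ≤ 1 := by
    rw [hδ, bias, div_le_one (by positivity)]
    refine (Finset.sum_le_card_nsmul _ _ 1 fun x _ => ?_).trans (by simp)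
    unfold signedVote
    split_ifs <;> norm_num
  have hfail : (answerLaw f g).real {a | margin c.bit a ≤ 0} ≤
      ∫ a, Real.exp (-(δ / 2) * margin c.bit a) ∂answerLaw f g := by
    rw [← integral_indicator_one .of_discrete]
    refine integral_mono .of_finite .of_finite fun a => ?_
    by_cases ha : margin c.bit a ≤ 0
    · simp only [Set.indicator, Set.mem_ofPred_eq, ha, if_true, Pi.one_apply]
      exact Real.one_le_exp (by nlinarith)
    · simp only [Set.indicator, Set.mem_ofPred_eq, ha, if_false]
      positivity
  have hprod (a : Fin g → Bool) : Real.exp (-(δ / 2) * margin c.bit a) =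
      ∏ i, Real.exp (-(δ / 2) * signedVote c.bit (a i)) := by
    rw [← Real.exp_sum, ← Finset.mul_sum, margin]
  simp_rw [hprod] at hfail
  rw [integral_prod_signedVote f g c.bit fun x => Real.exp (-(δ / 2) * x)] at hfail
  have hbase : (Real.exp (-(δ / 2) * 1) + Real.exp (-(δ / 2) * -1)) / 2 +
      δ * ((Real.exp (-(δ / 2) * 1) - Real.exp (-(δ / 2) * -1)) / 2) =
      Real.cosh (δ / 2) - δ * Real.sinh (δ / 2) := by
    rw [Real.cosh_eq, Real.sinh_eq]
    ring_nf
  -- The exponent δ/2 is not optimal but suffices: cosh(δ/2) ≤ exp(δ²/8) ≤ 1 + δ²/4 and δ·sinh(δ/2)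
  -- ≥ δ²/2 leave 1 - δ²/4.
  have hle : Real.cosh (δ / 2) - δ * Real.sinh (δ / 2) ≤ Real.exp (-(δ ^ 2 / 4)) := by
    have h1 := Real.cosh_le_exp_half_sq (δ / 2)
    have h2 : δ / 2 ≤ Real.sinh (δ / 2) := Real.self_le_sinh_iff.2 (by linarith)
    have h3 := Real.add_one_le_exp (-(δ ^ 2 / 4))
    have h4 := (abs_le.1 (Real.abs_exp_sub_one_le (x := (δ / 2) ^ 2 / 2)
      (by rw [abs_of_nonneg (by positivity)]; nlinarith))).2
    rw [abs_of_nonneg (by positivity)] at h4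
    nlinarith
  have hnn : 0 ≤ Real.cosh (δ / 2) - δ * Real.sinh (δ / 2) := by
    have h2 : 0 ≤ Real.sinh (δ / 2) := Real.sinh_nonneg_iff.2 (by linarith)
    have h3 := Real.sinh_lt_cosh (δ / 2)
    nlinarith
  have hpow : (answerLaw f g).real {a | margin c.bit a ≤ 0} ≤ Real.exp (-(g * δ ^ 2 / 4)) := by
    refine hfail.trans ?_
    rw [← hδ]
    simp only [RCLike.ofReal_real_eq_id, id_eq]
    rw [hbase]
    refine (pow_le_pow_left₀ hnn hle g).trans_eq ?_
    rw [← Real.exp_nat_mul]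
    ring_nf
  have hcompl := probReal_compl_eq_one_sub (μ := answerLaw f g) (s := {a | margin c.bit a ≤ 0})
    .of_discrete
  have hset : {a : Fin g → Bool | margin c.bit a ≤ 0}ᶜ = {a | 0 < margin c.bit a} := by
    ext a
    simp
  rw [hset] at hcompl
  rw [successProb_eq, hcompl]
  linarith [measureReal_nonneg (μ := answerLaw f g) (s := {a | margin c.bit a = 0})]

theorem successProb_le_one {n : ℕ} (f : BoolFun n) (g : ℕ) (c : Verdict) :
    successProb f g c ≤ 1 :=
  ENNReal.toReal_le_of_le_ofReal zero_le_one (by simpa using PMF.coe_le_one _ c)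

/-! ### The bias under the weight promise. -/

theorem bias_eq {n : ℕ} (f : BoolFun n) (c : Verdict) :
    bias f c.bit = match c with
      | .lower => 1 - 2 * (weight f / 2 ^ n)
      | .higher => 2 * (weight f / 2 ^ n) - 1 := by
  have h (x : Fin n → Bool) : signedVote true (f x) = 2 * (if f x = true then 1 else 0) - 1 := by
    unfold signedVote
    split_ifs <;> norm_num
  have h' (x : Fin n → Bool) : signedVote false (f x) = 1 - 2 * (if f x = true then 1 else 0) := by
    unfold signedVote
    cases f x <;> norm_num
  cases c
  · simp only [Verdict.bit, bias, h', weight, Finset.sum_sub_distrib, ← Finset.mul_sum]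
    simp
    field_simp
  · simp only [Verdict.bit, bias, h, weight, Finset.sum_sub_distrib, ← Finset.mul_sum]
    simp
    field_simp

/-- Without rounding, either weight gives bias exactly cos 2θ, and 2θ = π/2 - π/(4k+2). Rounding
moves the weight by at most 1/2, hence the bias by at most 1/2ⁿ. -/
theorem abs_bias_sub_sin_le {n : ℕ} (f : BoolFun n) (k : ℕ) (c : Verdict)
    (hw : (weight f : ℤ) = promisedWeight n k c) :
    |bias f c.bit - Real.sin (Real.pi / (4 * k + 2))| ≤ 1 / 2 ^ n := by
  set θ : ℝ := (k : ℝ) / (2 * k + 1) * (Real.pi / 2) with hθ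
  have hsin : Real.sin (Real.pi / (4 * k + 2)) = Real.cos (2 * θ) := by
    rw [← Real.cos_pi_div_two_sub, hθ]
    congr 1
    field_simp
    ring
  have hN : (0 : ℝ) < 2 ^ n := by positivity
  have hw' : (weight f : ℝ) = (promisedWeight n k c : ℤ) := by exact_mod_cast hw
  rw [hsin, bias_eq, le_div_iff₀ hN, ← abs_of_pos hN, ← abs_mul, abs_of_pos hN]
  cases c
  · have hr := abs_sub_round ((2 : ℝ) ^ n * Real.sin θ ^ 2)
    simp only [promisedWeight] at hw' ⊢
    rw [← hw'] at hr
    rw [Real.cos_two_mul, Real.cos_sq', show (1 - 2 * ((weight f : ℝ) / 2 ^ n) -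
      (2 * (1 - Real.sin θ ^ 2) - 1)) * 2 ^ n = 2 * (2 ^ n * Real.sin θ ^ 2 - weight f) by
        field_simp; ring, abs_mul, abs_two]
    linarith
  · have hr := abs_sub_round ((2 : ℝ) ^ n * Real.cos θ ^ 2)
    simp only [promisedWeight] at hw' ⊢
    rw [← hw'] at hr
    rw [Real.cos_two_mul, show (2 * ((weight f : ℝ) / 2 ^ n) - 1 -
      (2 * Real.cos θ ^ 2 - 1)) * 2 ^ n = -(2 * (2 ^ n * Real.cos θ ^ 2 - weight f)) by
        field_simp; ring, abs_neg, abs_mul, abs_two]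
    linarith

theorem tendsto_mul_bias {n : ℕ → ℕ} {c : ℕ → Verdict} {f : ∀ k, BoolFun (n k)}
    (hn : Tendsto (fun k : ℕ => (k : ℝ) / (2 : ℝ) ^ n k) atTop (𝓝 0))
    (hf : ∀ k, (weight (f k) : ℤ) = promisedWeight (n k) k (c k)) :
    Tendsto (fun k : ℕ => k * bias (f k) (c k).bit) atTop (𝓝 (Real.pi / 4)) := by
  have hu : Tendsto (fun k : ℕ => 4 * (k : ℝ) + 2) atTop atTop :=
    tendsto_atTop_add_const_right _ _
      (tendsto_natCast_atTop_atTop.const_mul_atTop (by norm_num))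
  have hq : Tendsto (fun k : ℕ => (1 - 2 * (4 * (k : ℝ) + 2)⁻¹) / 4) atTop (𝓝 (1 / 4)) := by
    simpa using (((tendsto_inv_atTop_zero.comp hu).const_mul 2).const_sub 1).div_const 4
  have hsin : Tendsto (fun k : ℕ => k * Real.sin (Real.pi / (4 * k + 2))) atTop
      (𝓝 (Real.pi / 4)) := by
    convert! hq.mul (tendsto_mul_sin_div hu Real.pi) using 2 with k
    · field_simp
      ring
    · ring
  refine hsin.congr_dist (squeeze_zero (fun _ => dist_nonneg) (fun k => ?_) hn)
  rw [dist_comm, Real.dist_eq, ← mul_sub, abs_mul, Nat.abs_cast, div_eq_mul_one_div (k : ℝ)]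
  exact mul_le_mul_of_nonneg_left (abs_bias_sub_sin_le (f k) k (c k) (hf k)) (Nat.cast_nonneg k)

/-! ### Query counts compared with k². -/

theorem IsRoundedPower.tendsto_div_rpow {g : ℕ → ℕ} {s : ℝ} (hg : IsRoundedPower g s)
    (hs : 0 < s) : Tendsto (fun k : ℕ => (g k : ℝ) / (k : ℝ) ^ s) atTop (𝓝 1) := by
  have hk : Tendsto (fun k : ℕ => (k : ℝ) ^ s) atTop atTop :=
    (tendsto_rpow_atTop hs).comp tendsto_natCast_atTop_atTop
  rw [tendsto_iff_dist_tendsto_zero]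
  refine squeeze_zero' (.of_forall fun _ => dist_nonneg) ?_ (tendsto_inv_atTop_zero.comp hk)
  filter_upwards [hk.eventually_gt_atTop 0] with k hk0
  rw [Real.dist_eq, div_sub_one hk0.ne', abs_div, abs_of_pos hk0, div_eq_mul_inv,
    Function.comp_apply]
  exact mul_le_of_le_one_left (by positivity) (hg k)

theorem IsRoundedPower.tendsto_atTop {g : ℕ → ℕ} {s : ℝ} (hg : IsRoundedPower g s)
    (hs : 0 < s) : Tendsto g atTop atTop := by
  have hk : Tendsto (fun k : ℕ => (k : ℝ) ^ s) atTop atTop :=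
    (tendsto_rpow_atTop hs).comp tendsto_natCast_atTop_atTop
  refine tendsto_natCast_atTop_iff.1 (tendsto_atTop_mono (fun k => ?_)
    (tendsto_atTop_add_const_right _ (-1) hk))
  linarith [(abs_le.1 (hg k)).1]

theorem hasAsymptoticSuccess_of_tendsto_div_sq {g : ℕ → ℕ} {r : ℝ} (hg : Tendsto g atTop atTop)
    (hr : Tendsto (fun k : ℕ => (g k : ℝ) / (k : ℝ) ^ 2) atTop (𝓝 r)) :
    HasAsymptoticSuccess g ((gaussianReal (√r * (Real.pi / 4)) 1).real (Set.Ioi 0)) := by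
  intro n c f hn hf
  refine tendsto_successProb f c hg ((hr.sqrt.mul (tendsto_mul_bias hn hf)).congr' ?_)
  filter_upwards [eventually_gt_atTop 0] with k hk
  rw [Real.sqrt_div' _ (by positivity), Real.sqrt_sq (Nat.cast_nonneg k)]
  field_simp

theorem hasAsymptoticSuccess_one_of_tendsto_div_sq {g : ℕ → ℕ}
    (hr : Tendsto (fun k : ℕ => (g k : ℝ) / (k : ℝ) ^ 2) atTop atTop) :
    HasAsymptoticSuccess g 1 := by
  intro n c f hn hf
  have hb := tendsto_mul_bias hn hf
  have hlim : Tendsto (fun k => 1 - Real.exp (-(g k * bias (f k) (c k).bit ^ 2 / 4))) atTop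
      (𝓝 1) := by
    -- gδ² = (g/k²)·(kδ)², with the second factor tending to (π/4)² > 0.
    have h1 : Tendsto (fun k => g k * bias (f k) (c k).bit ^ 2 / 4) atTop atTop := by
      refine ((hr.atTop_mul_pos (by positivity) (hb.pow 2)).atTop_div_const
        (by norm_num : (0 : ℝ) < 4)).congr' ?_
      filter_upwards [eventually_gt_atTop 0] with k hk
      field_simp
    simpa using (Real.tendsto_exp_neg_atTop_nhds_zero.comp h1).const_sub 1
  refine tendsto_of_tendsto_of_tendsto_of_le_of_le' hlim tendsto_const_nhds ?_
    (.of_forall fun k => successProb_le_one _ _ _)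
  filter_upwards [hb.eventually_const_lt (u := 0) (by positivity)] with k hk
  exact one_sub_exp_le_successProb _ _ _ (pos_of_mul_pos_right hk (Nat.cast_nonneg k)).le

theorem div_sq_eq_mul_rpow (x s : ℝ) {k : ℕ} (hk : 0 < k) :
    x / (k : ℝ) ^ 2 = x / (k : ℝ) ^ s * (k : ℝ) ^ (s - 2) := by
  have hk' : (0 : ℝ) < k := Nat.cast_pos.2 hk
  rw [Real.rpow_sub hk', Real.rpow_two]
  have := Real.rpow_pos_of_pos hk' s
  field_simp

end WeightDecision

theorem mainTheorem3 :
    (∀ g : ℕ → ℕ, WeightDecision.IsRoundedPower g 1 →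
      WeightDecision.HasAsymptoticSuccess g (1 / 2)) ∧
    (∃ p : ℝ, p < 4 / 5 ∧ ∀ g : ℕ → ℕ, WeightDecision.IsRoundedPower g 2 →
      WeightDecision.HasAsymptoticSuccess g p) ∧
    (∀ s : ℝ, 2 < s → ∀ g : ℕ → ℕ, WeightDecision.IsRoundedPower g s →
      WeightDecision.HasAsymptoticSuccess g 1) := by
  refine ⟨fun g hg => ?_, ⟨_, WeightDecision.gaussianReal_pi_div_four_lt, fun g hg => ?_⟩,
    fun s hs g hg => ?_⟩
  · have h0 : Filter.Tendsto (fun k : ℕ => (g k : ℝ) / (k : ℝ) ^ 2) Filter.atTop (nhds 0) := by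
      have h1 := (tendsto_rpow_neg_atTop one_pos).comp (tendsto_natCast_atTop_atTop (R := ℝ))
      refine (mul_zero (1 : ℝ) ▸ (hg.tendsto_div_rpow one_pos).mul h1).congr' ?_
      filter_upwards [Filter.eventually_gt_atTop 0] with k hk
      rw [WeightDecision.div_sq_eq_mul_rpow _ 1 hk, Function.comp_apply]
      norm_num
    simpa [WeightDecision.gaussianReal_zero_one_Ioi_zero] using
      WeightDecision.hasAsymptoticSuccess_of_tendsto_div_sq (hg.tendsto_atTop one_pos) h0
  · have h1 := hg.tendsto_div_rpow two_pos
    simp_rw [Real.rpow_two] at h1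
    simpa using WeightDecision.hasAsymptoticSuccess_of_tendsto_div_sq (hg.tendsto_atTop two_pos) h1
  · have h1 := (tendsto_rpow_atTop (sub_pos.2 hs)).comp (tendsto_natCast_atTop_atTop (R := ℝ))
    refine WeightDecision.hasAsymptoticSuccess_one_of_tendsto_div_sq
      (((hg.tendsto_div_rpow (two_pos.trans hs)).pos_mul_atTop one_pos h1).congr' ?_)
    filter_upwards [Filter.eventually_gt_atTop 0] with k hk
    rw [WeightDecision.div_sq_eq_mul_rpow _ s hk, Function.comp_apply]
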